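/- Let $V(x,y)$ be a real-valued function on the upper half-plane $\{(x,y): x\in\mathbb R,\ y>0\}$. **1.** The function $V$ is harmonic in the upper half-plane with $V(x,y)\ge 0$ and $V_x(x,y)\ge 0$ for all $x\in\mathbb R$, $y>0$ if and only if there exist a finite constant $\alpha\ge 0$ and a non-negative non-decreasing function $\nu$ on $\mathbb R$ such that $$\int_1^{+\infty}\frac{\nu(t)}{t^2}\,dt<+\infty \tag{a}$$ and $$V(x,y)=\alpha y+\int_{-\infty}^{+\infty}\frac{y}{y^2+(x-t)^2}\,\nu(t)\,dt,\qquad y>0,\ x\in\mathbb R. \tag{b}$$ For all such $\alpha,\nu$ the integral in (b) converges for all $x\in\mathbb R$, $y>0$. The representation (b) is unique if non-decreasing functions that are equal almost everywhere on $\mathbb R$ are identified: if $V$ is represented by $(\alpha,\nu)$, then it is represented by $(\alpha',\nu')$ if and only if $\alpha'=\alpha$, $\nu'$ is non-decreasing, and $\nu'=\nu$ almost everywhere on $\mathbb R$. **2.** Let $V$ be harmonic in the upper half-plane with $V\ge0$ and $V_x\ge0$ there. Then either $V_x(x,y)>0$ for all $x\in\mathbb R$, $y>0$, or $V_x(x,y)=0$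 for all $x\in\mathbb R$, $y>0$. The latter case holds if and only if the function $\nu$ in (b) is a constant $\nu(t)\equiv a\ge0$ (for any choice of the representation), or, what is the same, if and only if $V(x,y)=\beta y+\pi a$, $y>0$, $x\in\mathbb R$, with some constants $\beta,a\ge0$; in any such formula $\beta=\alpha$ and $\nu\equiv a$, and conversely, if $\nu\equiv a$, then $V(x,y)=\alpha y+\pi a$. -/

import Mathlib

open MeasureTheory Set

noncomputable section

/-- The partial derivative `V_x(x, y)` of a function `V(x, y) = V (x + i y)` on the plane. -/
def partialX (V : ℂ → ℝ) (x y : ℝ) : ℝ :=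
  deriv (fun s : ℝ => V ⟨s, y⟩) x

/-- `V` is harmonic in the open upper half-plane, and `V ≥ 0`, `V_x ≥ 0` there. Only the values
of `V` on the upper half-plane matter. -/
structure IsHarmonicNonnegMonotone (V : ℂ → ℝ) : Prop where
  harmonic : InnerProductSpace.HarmonicOnNhd V {z : ℂ | 0 < z.im}
  nonneg : ∀ x y : ℝ, 0 < y → 0 ≤ V ⟨x, y⟩
  partialX_nonneg : ∀ x y : ℝ, 0 < y → 0 ≤ partialX V x y

/-- The kernel `y / (y² + (x - t)²)`. -/
def halfPlaneKernel (x y t : ℝ) : ℝ :=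
  y / (y ^ 2 + (x - t) ^ 2)

/-- `α ≥ 0`, `ν` is a non-negative non-decreasing function on `ℝ` with
`∫_1^∞ ν(t) / t² dt < ∞` (the integrand is measurable and non-negative, so that this is
integrability), and `V(x, y) = α y + ∫ y / (y² + (x - t)²) ν(t) dt` for all `y > 0`, `x ∈ ℝ`. -/
structure IsRepresentedBy (V : ℂ → ℝ) (α : ℝ) (ν : ℝ → ℝ) : Prop where
  alpha_nonneg : 0 ≤ α
  nu_nonneg : ∀ t : ℝ, 0 ≤ ν t
  nu_mono : Monotone ν
  nu_integrable : IntegrableOn (fun t : ℝ => ν t / t ^ 2) (Ioi 1)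
  eq : ∀ x y : ℝ, 0 < y → V ⟨x, y⟩ = α * y + ∫ t : ℝ, halfPlaneKernel x y t * ν t

end

/-! For ε > 0 the shift V(z + iε) is harmonic up to the boundary. Composing it with maps onto
horodiscs, where Poisson's formula is the mean value property, and letting the horodiscs fill the
half-plane represents it by its boundary values plus a linear term. Then ε → 0: since V_x ≥ 0 the
boundary values are non-decreasing, the Poisson integral bounds them locally, and Helly's theorem
extracts an a.e. limit, which is πν. Both passages to the limit use
`exists_eq_add_integral_of_tendsto`: far out, the kernel of (x, y) is asymptotically y times that of
(0, 1), so mass lost at infinity reappears as a term αy.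

Conversely, a representation exhibits V as the imaginary part of a holomorphic function, and the
substitution t = x + ys shows monotonicity in x. The data are recovered as limits, α from V(0, y)/y
as y → ∞ and πν from V(x, y) as y → 0+ at continuity points of ν; hence uniqueness. If ν takes two
values, V(x + δ, y) − V(x, y) is at least a positive constant times δ for small δ > 0, so V_x > 0
everywhere; this yields the dichotomy. -/

open Filter Topology

/-! ### The kernel of the half-plane -/

theorem halfPlaneKernel_pos (x : ℝ) {y : ℝ} (hy : 0 < y) (t : ℝ) : 0 < halfPlaneKernel x y t := by
  unfold halfPlaneKernel; positivity

theorem continuous_halfPlaneKernel (x : ℝ) {y : ℝ} (hy : 0 < y) :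
    Continuous (halfPlaneKernel x y) := by
  unfold halfPlaneKernel
  exact continuous_const.div (by fun_prop) fun t => by positivity

theorem halfPlaneKernel_zero_one (t : ℝ) : halfPlaneKernel 0 1 t = (1 + t ^ 2)⁻¹ := by
  simp [halfPlaneKernel]

theorem exists_halfPlaneKernel_le (x : ℝ) {y : ℝ} (hy : 0 < y) :
    ∃ C, 0 < C ∧ ∀ t, halfPlaneKernel x y t ≤ C * (1 + t ^ 2)⁻¹ := by
  -- The constant comes from t² ≤ 2x² + 2(x − t)², that is (2x − t)² ≥ 0.
  refine ⟨y * ((1 + 2 * x ^ 2) / y ^ 2 + 2), by positivity, fun t => ?_⟩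
  have h : 1 + t ^ 2 ≤ ((1 + 2 * x ^ 2) / y ^ 2 + 2) * (y ^ 2 + (x - t) ^ 2) := by
    have h1 : (1 + 2 * x ^ 2) / y ^ 2 * y ^ 2 = 1 + 2 * x ^ 2 := by field_simp
    have h2 : 0 ≤ (1 + 2 * x ^ 2) / y ^ 2 * (x - t) ^ 2 := by positivity
    nlinarith [sq_nonneg (2 * x - t), sq_nonneg y]
  rw [halfPlaneKernel, ← div_eq_mul_inv, div_le_div_iff₀ (by positivity) (by positivity), mul_assoc]
  exact mul_le_mul_of_nonneg_left h hy.le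

/-- Far away from the origin the kernels of different points are proportional. -/
theorem exists_abs_halfPlaneKernel_sub_le (x : ℝ) {y : ℝ} (hy : 0 < y) :
    ∃ K, 0 < K ∧ ∀ T t : ℝ, 0 < T → T ≤ |t| →
      |halfPlaneKernel x y t - y * halfPlaneKernel 0 1 t| ≤ K / T * halfPlaneKernel 0 1 t := by
  obtain ⟨C, hC, hk⟩ := exists_halfPlaneKernel_le x hy
  set B : ℝ := 1 + y ^ 2 + x ^ 2 + 2 * |x| with hB
  have hB0 : 0 < B := by positivity
  refine ⟨2 * B * C, by positivity, fun T t hT ht => ?_⟩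
  have hnum : |1 - y ^ 2 - x ^ 2 + 2 * x * t| ≤ B * (1 + |t|) := by
    have h1 : |x * t| = |x| * |t| := abs_mul x t
    have := abs_le.1 h1.le
    have h2 : 0 ≤ |t| := abs_nonneg t
    have h3 : 0 ≤ |x| := abs_nonneg x
    rw [abs_le]
    constructor <;> nlinarith [sq_nonneg x, sq_nonneg y, mul_nonneg (sq_nonneg x) h2,
      mul_nonneg (sq_nonneg y) h2, neg_abs_le (x * t), le_abs_self (x * t)]
  have hsum : 1 + |t| ≤ 2 / T * (1 + t ^ 2) := by
    rw [div_mul_eq_mul_div, le_div_iff₀ hT]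
    nlinarith [sq_abs t, abs_nonneg t, sq_nonneg (1 - |t|)]
  -- The t² terms cancel in the numerator, so the relative error is linear over quadratic in t, of
  -- order 1/|t|.
  have heq : halfPlaneKernel x y t - y * halfPlaneKernel 0 1 t
      = (1 - y ^ 2 - x ^ 2 + 2 * x * t) * (1 + t ^ 2)⁻¹ * halfPlaneKernel x y t := by
    have : y ^ 2 + (x - t) ^ 2 ≠ 0 := by positivity
    have : 1 + t ^ 2 ≠ 0 := by positivity
    rw [halfPlaneKernel_zero_one, halfPlaneKernel]
    field_simp
    ring
  have hp : 0 < 1 + t ^ 2 := by positivity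
  rw [heq, abs_mul, abs_mul, abs_of_pos (inv_pos.2 hp), abs_of_pos (halfPlaneKernel_pos x hy t),
    halfPlaneKernel_zero_one]
  calc |1 - y ^ 2 - x ^ 2 + 2 * x * t| * (1 + t ^ 2)⁻¹ * halfPlaneKernel x y t
      ≤ B * (2 / T * (1 + t ^ 2)) * (1 + t ^ 2)⁻¹ * (C * (1 + t ^ 2)⁻¹) := by
        gcongr
        · exact (halfPlaneKernel_pos x hy t).le
        · exact hnum.trans (by gcongr)
        · exact hk t
    _ = 2 * B * C / T * (1 + t ^ 2)⁻¹ := by field_simp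

theorem integrable_halfPlaneKernel_mul {x y : ℝ} (hy : 0 < y) {g : ℝ → ℝ}
    (hg : Integrable fun t => halfPlaneKernel 0 1 t * g t) :
    Integrable fun t => halfPlaneKernel x y t * g t := by
  obtain ⟨C, hC, hk⟩ := exists_halfPlaneKernel_le x hy
  have hrw : (fun t => halfPlaneKernel x y t * g t)
      = fun t => (halfPlaneKernel x y t * (1 + t ^ 2)) * (halfPlaneKernel 0 1 t * g t) := by
    ext t
    rw [halfPlaneKernel_zero_one]
    field_simp
  rw [hrw]
  refine hg.bdd_mul (c := C) ?_ (ae_of_all _ fun t => ?_)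
  · exact ((continuous_halfPlaneKernel x hy).mul (by fun_prop)).aestronglyMeasurable
  · have hp : 0 < 1 + t ^ 2 := by positivity
    rw [Real.norm_of_nonneg (mul_pos (halfPlaneKernel_pos x hy t) hp).le]
    have := mul_le_mul_of_nonneg_right (hk t) hp.le
    rwa [inv_mul_cancel_right₀ hp.ne'] at this

theorem integrable_halfPlaneKernel (x : ℝ) {y : ℝ} (hy : 0 < y) :
    Integrable (halfPlaneKernel x y) := by
  simpa using integrable_halfPlaneKernel_mul (x := x) hy (g := fun _ => 1)
    (by simpa [halfPlaneKernel_zero_one] using integrable_inv_one_add_sq)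

/-- The substitution t = x + ys moves all dependence on (x, y) from the kernel into the argument of
g, where monotonicity and continuity of g can be used. -/
theorem integrable_halfPlaneKernel_mul_iff_comp {x y : ℝ} (hy : 0 < y) {g : ℝ → ℝ} :
    Integrable (fun t => halfPlaneKernel x y t * g t) ↔
      Integrable fun s => (1 + s ^ 2)⁻¹ * g (x + y * s) := by
  have h1 := integrable_comp_mul_left_iff
    (fun u => halfPlaneKernel x y (x + u) * g (x + u)) hy.ne'
  have h2 : Integrable (fun u => halfPlaneKernel x y (x + u) * g (x + u)) ↔
      Integrable (fun t => halfPlaneKernel x y t * g t) :=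
    ⟨fun h => by simpa using h.comp_add_left (-x), fun h => h.comp_add_left x⟩
  rw [← h2, ← h1]
  have : (fun s => halfPlaneKernel x y (x + y * s) * g (x + y * s))
      = fun s => y⁻¹ * ((1 + s ^ 2)⁻¹ * g (x + y * s)) := by
    ext s
    rw [halfPlaneKernel]
    have : y ^ 2 + (x - (x + y * s)) ^ 2 = y ^ 2 * (1 + s ^ 2) := by ring
    rw [this]
    field_simp
  rw [this]
  exact integrable_const_mul_iff (IsUnit.mk0 _ (inv_ne_zero hy.ne')) _

theorem integral_halfPlaneKernel_mul {x y : ℝ} (hy : 0 < y) (g : ℝ → ℝ) :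
    ∫ t, halfPlaneKernel x y t * g t = ∫ s, (1 + s ^ 2)⁻¹ * g (x + y * s) := by
  have h1 := Measure.integral_comp_mul_left
    (fun u => halfPlaneKernel x y (x + u) * g (x + u)) y
  rw [integral_add_left_eq_self (fun t => halfPlaneKernel x y t * g t), smul_eq_mul,
    abs_of_pos (inv_pos.2 hy), inv_mul_eq_div, eq_div_iff hy.ne', mul_comm, ← integral_const_mul]
    at h1
  rw [← h1]
  refine integral_congr_ae (ae_of_all _ fun s => ?_)
  have : y ^ 2 + (x - (x + y * s)) ^ 2 = y ^ 2 * (1 + s ^ 2) := by ring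
  simp only [halfPlaneKernel, this]
  field_simp

theorem integral_halfPlaneKernel (x : ℝ) {y : ℝ} (hy : 0 < y) :
    ∫ t, halfPlaneKernel x y t = Real.pi := by
  have h := integral_halfPlaneKernel_mul (x := x) hy (fun _ => 1)
  simpa only [mul_one, integral_univ_inv_one_add_sq] using h

/-! ### Limits of Poisson integrals -/

/-- A limit of Poisson integrals (with linear terms) of densities that converge almost everywhere
and boundedly on compact sets is again of this form: the mass that escapes to infinity contributes
a linear term. -/
theorem exists_eq_add_integral_of_tendsto {f : ℕ → ℝ → ℝ} {g : ℝ → ℝ} {a : ℕ → ℝ}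
    {c : ℕ → ℝ → ℝ → ℝ} {d : ℝ → ℝ → ℝ} (hf : ∀ n t, 0 ≤ f n t)
    (hm : ∀ n, AEStronglyMeasurable (f n))
    (hi : ∀ n, Integrable fun t => halfPlaneKernel 0 1 t * f n t) (ha : ∀ n, 0 ≤ a n)
    (hc : ∀ n x y, 0 < y → c n x y = a n * y + ∫ t, halfPlaneKernel x y t * f n t)
    (hd : ∀ x y, 0 < y → Tendsto (fun n => c n x y) atTop (𝓝 (d x y)))
    (hg : ∀ᵐ t, Tendsto (fun n => f n t) atTop (𝓝 (g t)))
    (hb : ∀ T, ∃ C, ∀ n t, |t| ≤ T → f n t ≤ C) :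
    (Integrable fun t => halfPlaneKernel 0 1 t * g t) ∧
      ∃ α, 0 ≤ α ∧ ∀ x y, 0 < y → d x y = α * y + ∫ t, halfPlaneKernel x y t * g t := by
  have hgm : AEStronglyMeasurable g := aestronglyMeasurable_of_tendsto_ae atTop hm hg
  have hg0 : ∀ᵐ t, 0 ≤ g t := hg.mono fun t ht => ge_of_tendsto' ht fun n => hf n t
  have hii : ∀ n x y, 0 < y → Integrable fun t => halfPlaneKernel x y t * f n t :=
    fun n x y hy => integrable_halfPlaneKernel_mul hy (hi n)
  have hloc : ∀ T x y, 0 < y → IntegrableOn (fun t => halfPlaneKernel x y t * g t) (Icc (-T) T) := by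
    intro T x y hy
    obtain ⟨C, hC⟩ := hb T
    refine (integrable_halfPlaneKernel x hy).integrableOn.mul_bdd (c := C) hgm.restrict ?_
    filter_upwards [ae_restrict_of_ae hg, ae_restrict_of_ae hg0, ae_restrict_mem measurableSet_Icc]
      with t h1 h2 h3
    rw [Real.norm_of_nonneg h2]
    exact le_of_tendsto' h1 fun n => hC n t (abs_le.2 h3)
  have hlim : ∀ T x y, 0 < y → Tendsto (fun n => ∫ t in Icc (-T) T, halfPlaneKernel x y t * f n t)
      atTop (𝓝 (∫ t in Icc (-T) T, halfPlaneKernel x y t * g t)) := by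
    intro T x y hy
    obtain ⟨C, hC⟩ := hb T
    refine tendsto_integral_of_dominated_convergence (fun t => halfPlaneKernel x y t * C)
      (fun n => (hii n x y hy).aestronglyMeasurable.restrict)
      ((integrable_halfPlaneKernel x hy).mul_const C).restrict (fun n => ?_) ?_
    · filter_upwards [ae_restrict_mem measurableSet_Icc] with t ht
      have hk := (halfPlaneKernel_pos x hy t).le
      rw [Real.norm_of_nonneg (mul_nonneg hk (hf n t))]
      exact mul_le_mul_of_nonneg_left (hC n t (abs_le.2 ht)) hk
    · filter_upwards [ae_restrict_of_ae hg] with t ht using ht.const_mul _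
  -- A Fatou-type bound, uniform in T, which makes the limit density integrable.
  have hle : ∀ T, ∫ t in Icc (-T) T, halfPlaneKernel 0 1 t * g t ≤ d 0 1 := by
    intro T
    refine le_of_tendsto_of_tendsto' (hlim T 0 1 one_pos) (hd 0 1 one_pos) fun n => ?_
    rw [hc n 0 1 one_pos]
    have := setIntegral_le_integral (s := Icc (-T) T) (hi n)
      (ae_of_all _ fun t => mul_nonneg (halfPlaneKernel_pos 0 one_pos t).le (hf n t))
    linarith [ha n]
  have hcov : AECover (volume : Measure ℝ) atTop fun n : ℕ => Icc (-(n : ℝ)) n :=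
    aecover_Icc (tendsto_neg_atTop_atBot.comp tendsto_natCast_atTop_atTop)
      tendsto_natCast_atTop_atTop
  have hgi : Integrable fun t => halfPlaneKernel 0 1 t * g t :=
    hcov.integrable_of_integral_bounded_of_nonneg_ae (d 0 1)
      (fun n => hloc n 0 1 one_pos)
      (hg0.mono fun t ht => mul_nonneg (halfPlaneKernel_pos 0 one_pos t).le ht)
      (Eventually.of_forall fun n => hle n)
  have hfull : ∀ x y, 0 < y → Tendsto (fun n : ℕ => ∫ t in Icc (-(n : ℝ)) n,
      halfPlaneKernel x y t * g t) atTop (𝓝 (∫ t, halfPlaneKernel x y t * g t)) := fun x y hy =>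
    hcov.integral_tendsto_of_countably_generated (integrable_halfPlaneKernel_mul hy hgi)
  -- The coefficient α is what the limit at (0, 1) has in excess of the integral of the limit
  -- density.
  refine ⟨hgi, d 0 1 - ∫ t, halfPlaneKernel 0 1 t * g t,
    sub_nonneg.2 (le_of_tendsto' (hfull 0 1 one_pos) fun n => hle n), fun x y hy => ?_⟩
  obtain ⟨K, hK, hker⟩ := exists_abs_halfPlaneKernel_sub_le x hy
  -- First n → ∞ with T fixed: outside [-T, T] the two kernels are proportional up to K/T, and the
  -- linear terms cancel exactly. Only afterwards T → ∞.
  have htail : ∀ T, 0 < T → |(d x y - ∫ t in Icc (-T) T, halfPlaneKernel x y t * g t)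
      - y * (d 0 1 - ∫ t in Icc (-T) T, halfPlaneKernel 0 1 t * g t)| ≤ K / T * d 0 1 := by
    intro T hT
    refine le_of_tendsto_of_tendsto'
      ((((hd x y hy).sub (hlim T x y hy)).sub
        (((hd 0 1 one_pos).sub (hlim T 0 1 one_pos)).const_mul y)).abs)
      ((hd 0 1 one_pos).const_mul (K / T)) fun n => ?_
    have e1 := integral_add_compl (measurableSet_Icc (a := -T) (b := T)) (hii n x y hy)
    have e2 := integral_add_compl (measurableSet_Icc (a := -T) (b := T)) (hi n)
    have hdiff : (c n x y - ∫ t in Icc (-T) T, halfPlaneKernel x y t * f n t)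
        - y * (c n 0 1 - ∫ t in Icc (-T) T, halfPlaneKernel 0 1 t * f n t)
        = ∫ t in (Icc (-T) T)ᶜ,
          (halfPlaneKernel x y t * f n t - y * (halfPlaneKernel 0 1 t * f n t)) := by
      rw [integral_sub (hii n x y hy).integrableOn ((hi n).const_mul y).integrableOn,
        integral_const_mul, hc n x y hy, hc n 0 1 one_pos]
      linear_combination y * e2 - e1
    rw [hdiff, ← Real.norm_eq_abs]
    calc ‖∫ t in (Icc (-T) T)ᶜ,
          (halfPlaneKernel x y t * f n t - y * (halfPlaneKernel 0 1 t * f n t))‖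
        ≤ ∫ t in (Icc (-T) T)ᶜ, K / T * (halfPlaneKernel 0 1 t * f n t) := by
          refine norm_integral_le_of_norm_le ((hi n).const_mul _).integrableOn ?_
          filter_upwards [ae_restrict_mem measurableSet_Icc.compl] with t ht
          have hTt : T ≤ |t| := by
            by_contra! h
            exact ht (abs_le.1 h.le)
          have := mul_le_mul_of_nonneg_right (hker T t hT hTt) (hf n t)
          rw [← mul_assoc, ← mul_assoc, ← sub_mul, norm_mul, Real.norm_eq_abs, Real.norm_eq_abs,
            abs_of_nonneg (hf n t)]
          exact this
      _ ≤ K / T * ∫ t, halfPlaneKernel 0 1 t * f n t := by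
          rw [integral_const_mul]
          exact mul_le_mul_of_nonneg_left (setIntegral_le_integral (hi n) (ae_of_all _ fun t =>
            mul_nonneg (halfPlaneKernel_pos 0 one_pos t).le (hf n t))) (by positivity)
      _ ≤ K / T * c n 0 1 := by
          rw [hc n 0 1 one_pos]
          exact mul_le_mul_of_nonneg_left (by linarith [ha n]) (by positivity)
  have hzero : |(d x y - ∫ t, halfPlaneKernel x y t * g t)
      - y * (d 0 1 - ∫ t, halfPlaneKernel 0 1 t * g t)| ≤ 0 * d 0 1 := by
    refine le_of_tendsto_of_tendsto
      (((tendsto_const_nhds.sub (hfull x y hy)).sub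
        ((tendsto_const_nhds.sub (hfull 0 1 one_pos)).const_mul y)).abs)
      (((tendsto_const_nhds (x := K)).div_atTop tendsto_natCast_atTop_atTop).mul_const (d 0 1)) ?_
    filter_upwards [eventually_gt_atTop 0] with n hn
    exact htail n (Nat.cast_pos.2 hn)
  rw [zero_mul] at hzero
  have := abs_eq_zero.1 (le_antisymm hzero (abs_nonneg _))
  linarith

/-! ### The Poisson formula for the half-plane -/

/-- Near g z the function f is the real part of a holomorphic function, and composition with g
preserves this. -/
theorem InnerProductSpace.HarmonicAt.comp_analyticAt {f : ℂ → ℝ} {g : ℂ → ℂ} {z : ℂ}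
    (hf : HarmonicAt f (g z)) (hg : AnalyticAt ℂ g z) : HarmonicAt (fun w => f (g w)) z := by
  obtain ⟨ε, hε, hball⟩ := Metric.isOpen_iff.1 (isOpen_setOfPred_harmonicAt (f := f)) (g z) hf
  obtain ⟨F, hF, hFf⟩ :=
    HarmonicOnNhd.exists_analyticOnNhd_ball_re_eq (f := f) (fun _ hy => hball hy)
  have hev : (fun w => f (g w)) =ᶠ[𝓝 z] fun w => (F (g w)).re := by
    filter_upwards [hg.continuousAt.preimage_mem_nhds (Metric.ball_mem_nhds (g z) hε)] with w hw
    exact (hFf hw).symm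
  rw [harmonicAt_congr_nhds hev]
  exact ((hF (g z) (Metric.mem_ball_self hε)).comp hg).harmonicAt_re

theorem integral_comp_two_mul_arctan (g : ℝ → ℝ) :
    ∫ s, (1 + s ^ 2)⁻¹ * g (2 * Real.arctan s) = 2⁻¹ * ∫ θ in Ioo (-Real.pi) Real.pi, g θ := by
  have himage : (fun s => 2 * Real.arctan s) '' univ = Ioo (-Real.pi) Real.pi := by
    ext θ
    simp only [image_univ, mem_range, mem_Ioo]
    constructor
    · rintro ⟨s, rfl⟩
      constructor <;> linarith [Real.neg_pi_div_two_lt_arctan s, Real.arctan_lt_pi_div_two s]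
    · rintro ⟨h1, h2⟩
      exact ⟨Real.tan (θ / 2), by rw [Real.arctan_tan (by linarith) (by linarith)]; ring⟩
  have h := integral_image_eq_integral_abs_deriv_smul (s := univ)
    (f := fun s => 2 * Real.arctan s) (f' := fun s => 2 * (1 / (1 + s ^ 2))) MeasurableSet.univ
    (fun s _ => ((Real.hasDerivAt_arctan s).const_mul 2).hasDerivWithinAt)
    (fun s _ t _ hst => Real.arctan_injective (by simpa using hst)) g
  rw [himage, setIntegral_univ] at h
  rw [h, ← integral_const_mul]
  refine integral_congr_ae (ae_of_all _ fun s => ?_)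
  have hp : (0 : ℝ) < 2 * (1 / (1 + s ^ 2)) := by positivity
  simp only [abs_of_pos hp, smul_eq_mul]
  field_simp

theorem circleMap_two_mul_arctan (s : ℝ) :
    circleMap 0 1 (2 * Real.arctan s) = (1 + s * Complex.I) / (1 - s * Complex.I) := by
  have hp : 0 < 1 + s ^ 2 := by positivity
  have hsq : ((√(1 + s ^ 2) : ℝ) : ℂ) ^ 2 = 1 + (s : ℂ) ^ 2 := by
    rw [← Complex.ofReal_pow, Real.sq_sqrt hp.le]; push_cast; rfl
  have hne : (1 + (s : ℂ) ^ 2) ≠ 0 := by exact_mod_cast hp.ne'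
  have hfac : 1 + (s : ℂ) ^ 2 = (1 + s * Complex.I) * (1 - s * Complex.I) := by
    linear_combination ((s : ℂ) ^ 2) * Complex.I_sq
  have h2 : (1 : ℂ) - s * Complex.I ≠ 0 := fun h => hne (by rw [hfac, h, mul_zero])
  have h1 : (1 : ℂ) + s * Complex.I ≠ 0 := fun h => hne (by rw [hfac, h, zero_mul])
  have hexp : Complex.exp (Real.arctan s * Complex.I)
      = (1 + s * Complex.I) / ((√(1 + s ^ 2) : ℝ) : ℂ) := by
    rw [Complex.exp_mul_I, ← Complex.ofReal_cos, ← Complex.ofReal_sin, Real.cos_arctan,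
      Real.sin_arctan]
    push_cast
    ring
  have h3 : ((2 * Real.arctan s : ℝ) : ℂ) * Complex.I
      = ((2 : ℕ) : ℂ) * (Real.arctan s * Complex.I) := by push_cast; ring
  rw [circleMap, zero_add, Complex.ofReal_one, one_mul, h3, Complex.exp_nat_mul, hexp, div_pow, hsq,
    hfac]
  field_simp

/-- The half-angle substitution θ = 2 arctan s turns the circle average into an integral against the
Cauchy density. -/
theorem circleAverage_eq_integral_one_add_sq (f : ℂ → ℝ) :
    Real.pi * Real.circleAverage f 0 1
      = ∫ s : ℝ, (1 + s ^ 2)⁻¹ * f ((1 + s * Complex.I) / (1 - s * Complex.I)) := by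
  have h := integral_comp_two_mul_arctan fun θ => f (circleMap 0 1 θ)
  simp only [circleMap_two_mul_arctan] at h
  have hper : Function.Periodic (fun θ => f (circleMap 0 1 θ)) (2 * Real.pi) := fun θ => by
    simp only [periodic_circleMap 0 1 θ]
  have h2 := hper.intervalIntegral_add_eq 0 (-Real.pi)
  rw [zero_add, show -Real.pi + 2 * Real.pi = Real.pi by ring,
    intervalIntegral.integral_of_le (by linarith [Real.pi_pos] : -Real.pi ≤ Real.pi),
    integral_Ioc_eq_integral_Ioo] at h2
  rw [h, Real.circleAverage_def, h2, smul_eq_mul]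
  have := Real.pi_ne_zero
  field_simp

/-- The Möbius map that fixes the origin and takes the closed upper half-plane to the horodisc
`{z : |z - i / (2 δ)| ≤ 1 / (2 δ)}`. -/
noncomputable def horodiscMap (δ : ℝ) (z : ℂ) : ℂ := z / (1 - δ * Complex.I * z)

theorem one_le_re_horodiscMap_denom {δ : ℝ} (hδ : 0 ≤ δ) {z : ℂ} (hz : 0 ≤ z.im) :
    1 ≤ (1 - δ * Complex.I * z).re := by
  simp only [Complex.sub_re, Complex.one_re, Complex.mul_re, Complex.mul_im, Complex.ofReal_re,
    Complex.ofReal_im, Complex.I_re, Complex.I_im]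
  nlinarith [mul_nonneg hδ hz]

theorem horodiscMap_denom_ne_zero {δ : ℝ} (hδ : 0 ≤ δ) {z : ℂ} (hz : 0 ≤ z.im) :
    1 - δ * Complex.I * z ≠ 0 := by
  intro h
  have := one_le_re_horodiscMap_denom hδ hz
  rw [h, Complex.zero_re] at this
  linarith

theorem norm_horodiscMap_le {δ : ℝ} (hδ : 0 ≤ δ) {z : ℂ} (hz : 0 ≤ z.im) :
    ‖horodiscMap δ z‖ ≤ ‖z‖ := by
  rw [horodiscMap, norm_div]
  exact div_le_self (norm_nonneg z)
    ((one_le_re_horodiscMap_denom hδ hz).trans (Complex.re_le_norm _))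

theorem horodiscMap_im_nonneg {δ : ℝ} (hδ : 0 ≤ δ) {z : ℂ} (hz : 0 ≤ z.im) :
    0 ≤ (horodiscMap δ z).im := by
  rw [horodiscMap, Complex.div_im, ← sub_div]
  refine div_nonneg ?_ (Complex.normSq_nonneg _)
  simp only [Complex.sub_re, Complex.one_re, Complex.mul_re, Complex.mul_im, Complex.ofReal_re,
    Complex.ofReal_im, Complex.I_re, Complex.I_im, Complex.sub_im, Complex.one_im]
  nlinarith [mul_nonneg hδ (sq_nonneg z.im), mul_nonneg hδ (sq_nonneg z.re)]

theorem norm_horodiscMap_ofReal_le {δ : ℝ} (hδ : 0 < δ) (t : ℝ) :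
    ‖horodiscMap δ t‖ ≤ δ⁻¹ := by
  rw [horodiscMap, norm_div]
  have h1 : δ * |t| ≤ ‖1 - δ * Complex.I * (t : ℂ)‖ := by
    refine le_trans (le_of_eq ?_) (Complex.abs_im_le_norm _)
    simp [abs_mul, abs_of_pos hδ]
  have h0 : 0 < ‖1 - δ * Complex.I * (t : ℂ)‖ :=
    norm_pos_iff.2 (horodiscMap_denom_ne_zero hδ.le (by simp))
  rw [div_le_iff₀ h0, Complex.norm_real, Real.norm_eq_abs, inv_mul_eq_div, le_div_iff₀ hδ]
  linarith

theorem continuous_horodiscMap_ofReal {δ : ℝ} (hδ : 0 ≤ δ) :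
    Continuous fun t : ℝ => horodiscMap δ t := by
  unfold horodiscMap
  exact Complex.continuous_ofReal.div (by fun_prop) fun t =>
    horodiscMap_denom_ne_zero hδ (by simp)

theorem tendsto_horodiscMap (z : ℂ) :
    Tendsto (fun n : ℕ => horodiscMap (1 / ((n : ℝ) + 1)) z) atTop (𝓝 z) := by
  have h : Tendsto (fun δ : ℝ => horodiscMap δ z) (𝓝 0) (𝓝 (horodiscMap 0 z)) := by
    unfold horodiscMap
    refine ContinuousAt.tendsto (f := fun δ : ℝ => z / (1 - δ * Complex.I * z)) ?_
    exact continuousAt_const.div (by fun_prop) (by simp)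
  have h0 : horodiscMap 0 z = z := by simp [horodiscMap]
  rw [h0] at h
  exact h.comp tendsto_one_div_add_atTop_nhds_zero_nat

/-- The quotient is `horodiscMap δ` after the Cayley map ζ ↦ (w + w̄ζ)/(1 + ζ), with 1 + ζ cleared.
It therefore stays regular at ζ = −1, the preimage of infinity, and is analytic up to the whole
circle. -/
theorem cayley_horodiscMap_im_nonneg {δ : ℝ} (hδ : 0 < δ) {w ζ : ℂ} (hw : 0 < w.im) (hζ : ‖ζ‖ ≤ 1) :
    1 + ζ - δ * Complex.I * (w + star w * ζ) ≠ 0 ∧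
      0 ≤ ((w + star w * ζ) / (1 + ζ - δ * Complex.I * (w + star w * ζ))).im := by
  have hsq : ζ.re * ζ.re + ζ.im * ζ.im ≤ 1 := by
    rw [← Complex.normSq_apply, Complex.normSq_eq_norm_sq]
    exact pow_le_one₀ (norm_nonneg ζ) hζ
  have hNr : (w + star w * ζ).re = w.re + w.re * ζ.re + w.im * ζ.im := by simp; ring
  have hNi : (w + star w * ζ).im = w.im + w.re * ζ.im - w.im * ζ.re := by simp; ring
  have key : (w + star w * ζ).im * (1 + ζ.re) - (w + star w * ζ).re * ζ.im
      = w.im * (1 - (ζ.re * ζ.re + ζ.im * ζ.im)) := by rw [hNr, hNi]; ring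
  have hkey := mul_nonneg hw.le (sub_nonneg.2 hsq)
  rw [← key] at hkey
  generalize hN : w + star w * ζ = N at *
  have hDr : (1 + ζ - δ * Complex.I * N).re = 1 + ζ.re + δ * N.im := by simp
  have hDi : (1 + ζ - δ * Complex.I * N).im = ζ.im - δ * N.re := by simp
  constructor
  · intro hD
    rw [hD, Complex.zero_re] at hDr
    rw [hD, Complex.zero_im] at hDi
    have h1 : 1 + ζ.re = -(δ * N.im) := by linarith
    have h2 : ζ.im = δ * N.re := by linarith
    rw [h1, h2] at hkey
    have h3 : δ * (N.im * N.im + N.re * N.re) ≤ 0 := by linarith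
    have h4 : N.im * N.im + N.re * N.re ≤ 0 := by
      by_contra! h
      linarith [mul_pos hδ h]
    have h5 : N.im = 0 := by nlinarith [mul_self_nonneg N.im, mul_self_nonneg N.re]
    have h6 : N.re = 0 := by nlinarith [mul_self_nonneg N.im, mul_self_nonneg N.re]
    rw [h5] at h1 hNi
    rw [h6] at h2
    rw [h2] at hNi
    have h7 : ζ.re = -1 := by linarith
    rw [h7] at hNi
    linarith
  · rw [Complex.div_im, ← sub_div]
    refine div_nonneg ?_ (Complex.normSq_nonneg _)
    rw [hDr, hDi]
    nlinarith [mul_nonneg hδ.le (mul_self_nonneg N.im), mul_nonneg hδ.le (mul_self_nonneg N.re)]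

open InnerProductSpace in
/-- The Poisson formula for a horodisc, written as an integral over the real line. -/
theorem integral_halfPlaneKernel_mul_comp_horodiscMap {U : ℂ → ℝ}
    (hU : HarmonicOnNhd U {z | 0 ≤ z.im}) {δ : ℝ} (hδ : 0 < δ) {x y : ℝ} (hy : 0 < y) :
    ∫ t : ℝ, halfPlaneKernel x y t * U (horodiscMap δ t)
      = Real.pi * U (horodiscMap δ ⟨x, y⟩) := by
  set w : ℂ := ⟨x, y⟩ with hw
  -- M takes 0 to `horodiscMap δ w`, so the mean value property of U ∘ M evaluates U there.
  set M : ℂ → ℂ := fun ζ => (w + star w * ζ) / (1 + ζ - δ * Complex.I * (w + star w * ζ)) with hM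
  have hharm : HarmonicOnNhd (fun ζ => U (M ζ)) (Metric.closedBall 0 |1|) := by
    intro ζ hζ
    rw [abs_one, mem_closedBall_zero_iff] at hζ
    obtain ⟨h1, h2⟩ := cayley_horodiscMap_im_nonneg hδ (w := w) hy hζ
    refine HarmonicAt.comp_analyticAt (hU (M ζ) h2) ?_
    exact AnalyticAt.fun_div (by fun_prop) (by fun_prop) h1
  have hmean := hharm.circleAverage_eq
  have hM0 : M 0 = horodiscMap δ w := by simp [hM, horodiscMap]
  rw [hM0] at hmean
  rw [← hmean, circleAverage_eq_integral_one_add_sq, integral_halfPlaneKernel_mul hy]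
  refine integral_congr_ae (ae_of_all _ fun s => ?_)
  have hs : (1 : ℂ) - s * Complex.I ≠ 0 := by
    intro h
    simpa using congrArg Complex.re h
  have hw1 : w = x + y * Complex.I := by rw [hw, Complex.mk_eq_add_mul_I]
  have hw2 : star w = x - y * Complex.I := by
    rw [hw1]; simp [sub_eq_add_neg]
  have hden := horodiscMap_denom_ne_zero hδ.le (z := ((x + y * s : ℝ) : ℂ)) (by simp)
  have hMs : M ((1 + s * Complex.I) / (1 - s * Complex.I)) = horodiscMap δ (x + y * s : ℝ) := by
    have hN : w + star w * ((1 + s * Complex.I) / (1 - s * Complex.I))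
        = ((x + y * s : ℝ) : ℂ) * (2 / (1 - s * Complex.I)) := by
      rw [hw2, hw1, mul_div_assoc', mul_div_assoc', eq_div_iff hs, add_mul, div_mul_cancel₀ _ hs]
      push_cast
      linear_combination (-2 * y * s : ℂ) * Complex.I_sq
    have h1 : 1 + (1 + s * Complex.I) / (1 - s * Complex.I) = 2 / (1 - s * Complex.I) := by
      field_simp
      ring
    have h2 : (2 : ℂ) / (1 - s * Complex.I) ≠ 0 := div_ne_zero two_ne_zero hs
    simp only [hM]
    rw [hN, h1, horodiscMap, show 2 / (1 - s * Complex.I) - δ * Complex.I *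
      (((x + y * s : ℝ) : ℂ) * (2 / (1 - s * Complex.I)))
      = (1 - δ * Complex.I * ((x + y * s : ℝ) : ℂ)) * (2 / (1 - s * Complex.I)) by ring,
      mul_div_mul_right _ _ h2]
  simp only [hMs]

open InnerProductSpace in
/-- The Poisson formula for non-negative functions that are harmonic up to the boundary of the
half-plane. -/
theorem exists_poisson_of_harmonicOnNhd {U : ℂ → ℝ}
    (hU : HarmonicOnNhd U {z | 0 ≤ z.im}) (hU0 : ∀ z : ℂ, 0 ≤ z.im → 0 ≤ U z) :
    (Integrable fun t : ℝ => halfPlaneKernel 0 1 t * U t) ∧ ∃ α, 0 ≤ α ∧ ∀ x y : ℝ, 0 < y →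
      Real.pi * U ⟨x, y⟩ = α * y + ∫ t : ℝ, halfPlaneKernel x y t * U t := by
  have hδ : ∀ n : ℕ, 0 < 1 / ((n : ℝ) + 1) := fun n => Nat.one_div_pos_of_nat
  have hcont : ContinuousOn U {z | 0 ≤ z.im} := hU.continuousOn
  have hSim : ∀ (n : ℕ) (z : ℂ), 0 ≤ z.im → horodiscMap (1 / ((n : ℝ) + 1)) z ∈ {z : ℂ | 0 ≤ z.im} :=
    fun n z hz => horodiscMap_im_nonneg (hδ n).le hz
  have hbdd : ∀ R : ℝ, ∃ C, ∀ z : ℂ, 0 ≤ z.im → ‖z‖ ≤ R → ‖U z‖ ≤ C := by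
    intro R
    have hcomp : IsCompact ({z : ℂ | 0 ≤ z.im} ∩ Metric.closedBall 0 R) :=
      (isCompact_closedBall 0 R).inter_left (isClosed_le continuous_const Complex.continuous_im)
    obtain ⟨C, hC⟩ := hcomp.exists_bound_of_continuousOn (hcont.mono inter_subset_left)
    exact ⟨C, fun z hz hzR => hC z ⟨hz, by simpa using hzR⟩⟩
  have hfc : ∀ n : ℕ, Continuous fun t : ℝ => U (horodiscMap (1 / ((n : ℝ) + 1)) t) := fun n =>
    hcont.comp_continuous (continuous_horodiscMap_ofReal (hδ n).le) fun t => hSim n t (by simp)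
  have hlim : ∀ z : ℂ, 0 ≤ z.im →
      Tendsto (fun n : ℕ => U (horodiscMap (1 / ((n : ℝ) + 1)) z)) atTop (𝓝 (U z)) := by
    intro z hz
    have h := ((hU z hz).1.continuousAt).tendsto.comp (tendsto_horodiscMap z)
    exact h
  -- The horodisc formulas have no linear term; α arises only in the limit δ → 0.
  refine exists_eq_add_integral_of_tendsto (a := fun _ => 0)
    (f := fun n t => U (horodiscMap (1 / ((n : ℝ) + 1)) t))
    (c := fun n x y => Real.pi * U (horodiscMap (1 / ((n : ℝ) + 1)) ⟨x, y⟩))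
    (d := fun x y => Real.pi * U ⟨x, y⟩)
    (fun n t => hU0 _ (hSim n t (by simp))) (fun n => (hfc n).aestronglyMeasurable) ?_
    (fun _ => le_rfl) ?_ (fun x y hy => (hlim _ hy.le).const_mul _)
    (ae_of_all _ fun t => hlim t (by simp)) ?_
  · intro n
    -- For fixed δ the real line is mapped into the disc of radius 1/δ, so the density is bounded.
    obtain ⟨C, hC⟩ := hbdd (1 / ((n : ℝ) + 1))⁻¹
    exact (integrable_halfPlaneKernel 0 one_pos).mul_bdd (c := C) (hfc n).aestronglyMeasurable
      (ae_of_all _ fun t => hC _ (hSim n t (by simp)) (norm_horodiscMap_ofReal_le (hδ n) t))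
  · intro n x y hy
    rw [integral_halfPlaneKernel_mul_comp_horodiscMap hU (hδ n) hy]
    ring
  · intro T
    obtain ⟨C, hC⟩ := hbdd T
    refine ⟨C, fun n t ht => (le_abs_self _).trans (hC _ (hSim n t (by simp)) ?_)⟩
    refine (norm_horodiscMap_le (hδ n).le (by simp)).trans ?_
    simpa using ht

/-! ### Monotone functions -/

/-- **Helly's selection theorem**, with almost everywhere convergence. -/
theorem exists_subseq_tendsto_ae_of_monotone {f : ℕ → ℝ → ℝ} (hf : ∀ n, Monotone (f n))
    (hb : ∀ t, ∃ C, ∀ n, |f n t| ≤ C) :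
    ∃ (g : ℝ → ℝ) (φ : ℕ → ℕ), StrictMono φ ∧ Monotone g ∧
      ∀ᵐ t, Tendsto (fun n => f (φ n) t) atTop (𝓝 (g t)) := by
  choose C hC using hb
  obtain ⟨a, -, φ, hφ, hlim⟩ := (isCompact_univ_pi fun q : ℚ =>
    isCompact_Icc (a := -C q) (b := C q)).tendsto_subseq
    (x := fun n (q : ℚ) => f n q) fun n q _ => abs_le.1 (hC q n)
  have hq : ∀ q : ℚ, Tendsto (fun n => f (φ n) q) atTop (𝓝 (a q)) := fun q =>
    (tendsto_pi_nhds.1 hlim) q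
  have ha : Monotone a := fun q r hqr =>
    le_of_tendsto_of_tendsto' (hq q) (hq r) fun n => hf _ (Rat.cast_le.2 hqr)
  -- The limit on the rationals is extended from the right; at continuity points of g, rationals on
  -- both sides squeeze the sequence.
  set g : ℝ → ℝ := fun t => ⨅ q : {q : ℚ // t < q}, a q with hg
  have hne : ∀ t : ℝ, Nonempty {q : ℚ // t < q} := fun t =>
    let ⟨q, hq⟩ := exists_rat_gt t
    ⟨⟨q, hq⟩⟩
  have hbdd : ∀ t : ℝ, BddBelow (range fun q : {q : ℚ // t < q} => a q) := by
    intro t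
    obtain ⟨r, hr⟩ := exists_rat_lt t
    refine ⟨a r, ?_⟩
    rintro _ ⟨q, rfl⟩
    exact ha (by exact_mod_cast (hr.trans q.2).le)
  have hle : ∀ (t : ℝ) (q : ℚ), t < q → g t ≤ a q := fun t q h => ciInf_le (hbdd t) ⟨q, h⟩
  have hge : ∀ (t : ℝ) (q : ℚ), (q : ℝ) ≤ t → a q ≤ g t := fun t q h =>
    haveI := hne t
    le_ciInf fun r => ha (by exact_mod_cast (h.trans_lt r.2).le)
  have hgm : Monotone g := fun s t hst =>
    haveI := hne t
    le_ciInf fun q => hle s q (hst.trans_lt q.2)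
  refine ⟨g, φ, hφ, hgm, ?_⟩
  filter_upwards [hgm.countable_not_continuousAt.ae_notMem volume] with t ht
  have hct : ContinuousAt g t := not_not.1 ht
  refine tendsto_order.2 ⟨fun b hb => ?_, fun b hb => ?_⟩
  · obtain ⟨s, hs, hst⟩ := (((hct.eventually_const_lt hb).filter_mono
      (nhdsWithin_le_nhds (s := Iio t))).and self_mem_nhdsWithin).exists
    obtain ⟨q, hsq, hqt⟩ := exists_rat_btwn hst
    filter_upwards [(hq q).eventually_const_lt (hs.trans_le (hle s q hsq))] with n hn
    exact hn.trans_le (hf _ hqt.le)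
  · obtain ⟨s, hs, hst⟩ := (((hct.eventually_lt_const hb).filter_mono
      (nhdsWithin_le_nhds (s := Ioi t))).and self_mem_nhdsWithin).exists
    obtain ⟨q, htq, hqs⟩ := exists_rat_btwn hst
    filter_upwards [(hq q).eventually_lt_const ((hge s q hqs.le).trans_lt hs)] with n hn
    exact (hf _ htq.le).trans_lt hn

theorem Monotone.le_of_ae_le {g : ℝ → ℝ} (hg : Monotone g) {a : ℝ} (h : ∀ᵐ t, a ≤ g t) (t : ℝ) :
    a ≤ g t := by
  obtain ⟨s, hs, hst⟩ := (Measure.dense_of_ae h).exists_lt t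
  exact hs.trans (hg hst.le)

theorem Monotone.ge_of_ae_ge {g : ℝ → ℝ} (hg : Monotone g) {a : ℝ} (h : ∀ᵐ t, g t ≤ a) (t : ℝ) :
    g t ≤ a := by
  obtain ⟨s, hs, hst⟩ := (Measure.dense_of_ae h).exists_gt t
  exact (hg hst.le).trans hs

/-- On (−∞, 1] monotonicity gives the bound ν 1, so only the right tail matters, and there 1/t² and
1/(1 + t²) are comparable. -/
theorem Monotone.integrableOn_div_sq_iff {ν : ℝ → ℝ} (hν : Monotone ν) (h0 : ∀ t, 0 ≤ ν t) :
    IntegrableOn (fun t : ℝ => ν t / t ^ 2) (Ioi 1) ↔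
      Integrable fun t => halfPlaneKernel 0 1 t * ν t := by
  have hk := fun t => (halfPlaneKernel_pos 0 one_pos t).le
  constructor
  · intro h
    rw [← integrableOn_univ, ← Iic_union_Ioi (a := (1 : ℝ))]
    refine IntegrableOn.union ?_ ?_
    · refine (integrable_halfPlaneKernel 0 one_pos).integrableOn.mul_bdd (c := ν 1)
        hν.measurable.aestronglyMeasurable ?_
      filter_upwards [ae_restrict_mem measurableSet_Iic] with t ht
      rw [Real.norm_of_nonneg (h0 t)]
      exact hν ht
    · refine Integrable.mono' h ((continuous_halfPlaneKernel 0 one_pos).aestronglyMeasurable.mul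
        hν.measurable.aestronglyMeasurable) ?_
      filter_upwards [ae_restrict_mem measurableSet_Ioi] with t ht
      have ht0 : (0 : ℝ) < t := one_pos.trans ht
      rw [Real.norm_of_nonneg (mul_nonneg (hk t) (h0 t)), halfPlaneKernel_zero_one, inv_mul_eq_div]
      exact div_le_div_of_nonneg_left (h0 t) (by positivity) (by linarith)
  · intro h
    refine Integrable.mono' (h.const_mul 2).integrableOn
      (hν.measurable.div (by fun_prop)).aestronglyMeasurable ?_
    filter_upwards [ae_restrict_mem measurableSet_Ioi] with t ht
    have ht1 : (1 : ℝ) < t := ht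
    have ht0 : (0 : ℝ) < t := one_pos.trans ht
    rw [Real.norm_of_nonneg (div_nonneg (h0 t) (sq_nonneg t)), halfPlaneKernel_zero_one,
      inv_mul_eq_div, mul_div_assoc', div_le_div_iff₀ (by positivity) (by positivity)]
    nlinarith [mul_nonneg (h0 t) (by nlinarith : (0 : ℝ) ≤ t ^ 2 - 1)]

/-! ### Existence of the representation -/

theorem IsHarmonicNonnegMonotone.differentiableAt {V : ℂ → ℝ} (hV : IsHarmonicNonnegMonotone V)
    {y : ℝ} (hy : 0 < y) (x : ℝ) : DifferentiableAt ℝ (fun s : ℝ => V ⟨s, y⟩) x := by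
  have h1 : DifferentiableAt ℝ V (x + y * Complex.I) :=
    (hV.harmonic _ (by simpa using hy)).1.differentiableAt two_ne_zero
  have h2 : (fun s : ℝ => V ⟨s, y⟩) = fun s : ℝ => V (s + y * Complex.I) := by
    ext s
    rw [Complex.mk_eq_add_mul_I]
  rw [h2]
  have h3 : DifferentiableAt ℝ (fun s : ℝ => (s : ℂ) + y * Complex.I) x :=
    Complex.ofRealCLM.differentiableAt.add_const _
  exact DifferentiableAt.comp x h1 h3

theorem IsHarmonicNonnegMonotone.monotone {V : ℂ → ℝ} (hV : IsHarmonicNonnegMonotone V) {y : ℝ}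
    (hy : 0 < y) : Monotone fun s : ℝ => V ⟨s, y⟩ :=
  monotone_of_deriv_nonneg (hV.differentiableAt hy) fun s => hV.partialX_nonneg s y hy

theorem IsHarmonicNonnegMonotone.exists_isRepresentedBy {V : ℂ → ℝ}
    (hV : IsHarmonicNonnegMonotone V) : ∃ (α : ℝ) (ν : ℝ → ℝ), IsRepresentedBy V α ν := by
  have hε : ∀ n : ℕ, 0 < 1 / ((n : ℝ) + 1) := fun n => Nat.one_div_pos_of_nat
  have hV0 : ∀ z : ℂ, 0 < z.im → 0 ≤ V z := fun z hz => hV.nonneg z.re z.im hz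
  have him : ∀ (n : ℕ) (z : ℂ), 0 ≤ z.im →
      0 < (z + (1 / ((n : ℝ) + 1) : ℝ) * Complex.I).im := by
    intro n z hz
    have := hε n
    simp only [Complex.add_im, Complex.im_ofReal_mul, Complex.I_im, mul_one]
    linarith
  have hP := fun n : ℕ => exists_poisson_of_harmonicOnNhd
    (U := fun z => V (z + (1 / ((n : ℝ) + 1) : ℝ) * Complex.I))
    (fun z hz => InnerProductSpace.HarmonicAt.comp_analyticAt (hV.harmonic _ (him n z hz))
      (by fun_prop)) fun z hz => hV0 _ (him n z hz)
  choose hi a ha hc using hP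
  set f : ℕ → ℝ → ℝ := fun n t => V (t + (1 / ((n : ℝ) + 1) : ℝ) * Complex.I) with hf
  have hf0 : ∀ n t, 0 ≤ f n t := fun n t => hV0 _ (him n t (by simp))
  have hmono : ∀ n, Monotone (f n) := by
    intro n s t hst
    simp only [hf, ← Complex.mk_eq_add_mul_I]
    exact hV.monotone (hε n) hst
  have hlim : ∀ x y : ℝ, 0 < y → Tendsto (fun n : ℕ =>
      Real.pi * V (⟨x, y⟩ + (1 / ((n : ℝ) + 1) : ℝ) * Complex.I)) atTop (𝓝 (Real.pi * V ⟨x, y⟩)) := by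
    intro x y hy
    refine Tendsto.const_mul _ ?_
    have hcV : ContinuousAt V ⟨x, y⟩ := (hV.harmonic ⟨x, y⟩ hy).1.continuousAt
    refine hcV.tendsto.comp ?_
    have h1 : Tendsto (fun n : ℕ => (1 / ((n : ℝ) + 1) : ℝ)) atTop (𝓝 0) :=
      tendsto_one_div_add_atTop_nhds_zero_nat
    have h2 := (Complex.continuous_ofReal.tendsto _).comp h1
    simpa using (h2.mul_const Complex.I).const_add (⟨x, y⟩ : ℂ)
  -- On [t, t + 1] the kernel of (t, 1) is at least 1/2 and the density is at least its value at t,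
  -- so the Poisson integral controls that value.
  have hbound : ∀ n t, f n t ≤ 2 * (Real.pi * V (⟨t, 1⟩ + (1 / ((n : ℝ) + 1) : ℝ) * Complex.I)) := by
    intro n t
    have hint := integrable_halfPlaneKernel_mul (x := t) one_pos (hi n)
    have h1 := setIntegral_le_integral (s := Icc t (t + 1)) hint
      (ae_of_all _ fun s => mul_nonneg (halfPlaneKernel_pos t one_pos s).le (hf0 n s))
    have h2 : ∫ _ in Icc t (t + 1), f n t / 2 ≤
        ∫ s in Icc t (t + 1), halfPlaneKernel t 1 s * f n s := by
      refine setIntegral_mono_on (integrableOn_const (by simp)) hint.integrableOn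
        measurableSet_Icc fun s hs => ?_
      have hk : 1 / 2 ≤ halfPlaneKernel t 1 s := by
        rw [halfPlaneKernel]
        exact div_le_div_of_nonneg_left zero_le_one (by positivity) (by nlinarith [hs.1, hs.2])
      calc f n t / 2 = 1 / 2 * f n t := by ring
        _ ≤ halfPlaneKernel t 1 s * f n s :=
          mul_le_mul hk (hmono n hs.1) (hf0 n t) (halfPlaneKernel_pos t one_pos s).le
    rw [setIntegral_const, Real.volume_real_Icc_of_le (by linarith), smul_eq_mul] at h2
    have h3 := hc n t 1 one_pos
    have h4 := ha n
    simp only [hf] at *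
    linarith
  have hbdd : ∀ t, ∃ C, ∀ n, f n t ≤ C := by
    intro t
    obtain ⟨C, hC⟩ := ((hlim t 1 one_pos).const_mul 2).bddAbove_range
    exact ⟨C, fun n => (hbound n t).trans (hC (mem_range_self n))⟩
  obtain ⟨g, φ, hφ, hg, hae⟩ := exists_subseq_tendsto_ae_of_monotone hmono fun t => by
    obtain ⟨C, hC⟩ := hbdd t
    exact ⟨C, fun n => by rw [abs_of_nonneg (hf0 n t)]; exact hC n⟩
  have hg0 := hg.le_of_ae_le (hae.mono fun t ht => ge_of_tendsto' ht fun n => hf0 _ t)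
  obtain ⟨hgi, α, hα, heq⟩ := exists_eq_add_integral_of_tendsto
    (f := fun n => f (φ n)) (g := g) (a := fun n => a (φ n))
    (c := fun n x y => Real.pi * V (⟨x, y⟩ + (1 / ((φ n : ℝ) + 1) : ℝ) * Complex.I))
    (d := fun x y => Real.pi * V ⟨x, y⟩) (fun n => hf0 _)
    (fun n => (hmono _).measurable.aestronglyMeasurable) (fun n => hi _) (fun n => ha _)
    (fun n => hc _) (fun x y hy => (hlim x y hy).comp hφ.tendsto_atTop) hae fun T => by
      obtain ⟨C, hC⟩ := hbdd T
      exact ⟨C, fun n t ht => (hmono _ ((le_abs_self t).trans ht)).trans (hC _)⟩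
  have hpi := Real.pi_pos
  refine ⟨α / Real.pi, fun t => g t / Real.pi, div_nonneg hα hpi.le,
    fun t => div_nonneg (hg0 t) hpi.le, fun s t hst => div_le_div_of_nonneg_right (hg hst) hpi.le,
    ?_, fun x y hy => ?_⟩
  · refine (((hg.integrableOn_div_sq_iff hg0).2 hgi).div_const Real.pi).congr ?_
    exact ae_of_all _ fun t => div_right_comm _ _ _
  · have h1 : (fun t => halfPlaneKernel x y t * (g t / Real.pi))
        = fun t => halfPlaneKernel x y t * g t / Real.pi := by
      ext t
      ring
    rw [h1, integral_div, div_mul_eq_mul_div, ← add_div, ← heq x y hy, mul_div_cancel_left₀ _ hpi.ne']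

/-! ### Functions with a representation -/

namespace IsRepresentedBy

variable {V : ℂ → ℝ} {α : ℝ} {ν : ℝ → ℝ}

theorem integrable (h : IsRepresentedBy V α ν) (x : ℝ) {y : ℝ} (hy : 0 < y) :
    Integrable fun t => halfPlaneKernel x y t * ν t :=
  integrable_halfPlaneKernel_mul hy ((h.nu_mono.integrableOn_div_sq_iff h.nu_nonneg).1
    h.nu_integrable)

theorem eq_integral_comp (h : IsRepresentedBy V α ν) (x : ℝ) {y : ℝ} (hy : 0 < y) :
    V ⟨x, y⟩ = α * y + ∫ s, (1 + s ^ 2)⁻¹ * ν (x + y * s) := by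
  rw [h.eq x y hy, integral_halfPlaneKernel_mul hy]

theorem monotone (h : IsRepresentedBy V α ν) {y : ℝ} (hy : 0 < y) :
    Monotone fun x : ℝ => V ⟨x, y⟩ := by
  intro x₁ x₂ hx
  simp only [h.eq_integral_comp _ hy]
  refine add_le_add_right (integral_mono
    ((integrable_halfPlaneKernel_mul_iff_comp hy).1 (h.integrable x₁ hy))
    ((integrable_halfPlaneKernel_mul_iff_comp hy).1 (h.integrable x₂ hy)) fun s => ?_) _
  exact mul_le_mul_of_nonneg_left (h.nu_mono (by linarith)) (by positivity)

/-- Up to the factor ν, the integrand of G is 1/(t − z) − t/(1 + t²), whose imaginary part is the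
kernel; the real correction secures convergence, since ν(t)/(t − z) alone need not be integrable. -/
theorem harmonicOnNhd (h : IsRepresentedBy V α ν) :
    InnerProductSpace.HarmonicOnNhd V {z : ℂ | 0 < z.im} := by
  set m : ℝ → ℝ := fun t => halfPlaneKernel 0 1 t * ν t with hm
  have hmi : Integrable m := h.integrable 0 one_pos
  have hmc : Integrable fun t => (m t : ℂ) := hmi.ofReal
  have hne : ∀ z : ℂ, 0 < z.im → ∀ t : ℝ, (t : ℂ) - z ≠ 0 := by
    intro z hz t h0
    have := congrArg Complex.im h0
    simp at this
    exact hz.ne' this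
  have hlow : ∀ (z : ℂ) (t : ℝ), z.im ≤ ‖(t : ℂ) - z‖ := by
    intro z t
    refine le_trans ?_ (Complex.abs_im_le_norm _)
    simpa using le_abs_self z.im
  have hmeas : ∀ z : ℂ, AEStronglyMeasurable
      (fun t : ℝ => (z + (1 + z ^ 2) / ((t : ℂ) - z)) * (m t : ℂ)) := fun z =>
    (by fun_prop : Measurable fun t : ℝ => z + (1 + z ^ 2) / ((t : ℂ) - z)).aestronglyMeasurable.mul
      hmc.aestronglyMeasurable
  have hFi : ∀ z : ℂ, 0 < z.im →
      Integrable fun t : ℝ => (z + (1 + z ^ 2) / ((t : ℂ) - z)) * (m t : ℂ) := by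
    intro z hz
    refine hmc.bdd_mul (c := ‖z‖ + ‖1 + z ^ 2‖ / z.im)
      (by fun_prop : Measurable fun t : ℝ => z + (1 + z ^ 2) / ((t : ℂ) - z)).aestronglyMeasurable
      (ae_of_all _ fun t => (norm_add_le _ _).trans ?_)
    rw [norm_div]
    exact add_le_add_right (div_le_div_of_nonneg_left (norm_nonneg _) hz (hlow z t)) _
  set G : ℂ → ℂ := fun z => ∫ t : ℝ, (z + (1 + z ^ 2) / ((t : ℂ) - z)) * (m t : ℂ) with hG
  have hopen : IsOpen {z : ℂ | 0 < z.im} := isOpen_lt continuous_const Complex.continuous_im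
  have hGd : DifferentiableOn ℂ G {z : ℂ | 0 < z.im} := by
    intro z₀ hz₀
    have hz₀ : 0 < z₀.im := hz₀
    have hball : ∀ z ∈ Metric.ball z₀ (z₀.im / 2), 0 < z.im ∧
        ∀ t : ℝ, ‖(t : ℂ) - z₀‖ ≤ 2 * ‖(t : ℂ) - z‖ := by
      intro z hz
      have h1 : ‖z - z₀‖ < z₀.im / 2 := by simpa [dist_eq_norm] using hz
      have h2 := (abs_le.1 ((Complex.abs_im_le_norm (z - z₀)).trans h1.le)).1
      rw [Complex.sub_im] at h2
      refine ⟨by linarith, fun t => ?_⟩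
      have h3 : ‖(t : ℂ) - z₀‖ ≤ ‖(t : ℂ) - z‖ + ‖z - z₀‖ := norm_sub_le_norm_sub_add_norm_sub ..
      linarith [hlow z₀ t]
    refine (hasDerivAt_integral_of_dominated_loc_of_deriv_le
      (F := fun (z : ℂ) (t : ℝ) => (z + (1 + z ^ 2) / ((t : ℂ) - z)) * (m t : ℂ))
      (F' := fun (z : ℂ) (t : ℝ) => (1 + (t : ℂ) ^ 2) / ((t : ℂ) - z) ^ 2 * (m t : ℂ))
      -- The derivative has size ν(t)/|t − z|², and |t − z₀| ≤ 2|t − z| on the ball gives the factor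
      -- 4.
      (bound := fun t => 4 / z₀.im * (halfPlaneKernel z₀.re z₀.im t * ν t))
      (Metric.ball_mem_nhds z₀ (half_pos hz₀)) (Eventually.of_forall hmeas) (hFi z₀ hz₀)
      ((by fun_prop : Measurable fun t : ℝ =>
        (1 + (t : ℂ) ^ 2) / ((t : ℂ) - z₀) ^ 2).aestronglyMeasurable.mul hmc.aestronglyMeasurable)
      (ae_of_all _ fun t z hz => ?_) ((h.integrable z₀.re hz₀).const_mul _)
      (ae_of_all _ fun t z hz => ?_)).2.differentiableAt.differentiableWithinAt
    · obtain ⟨hz1, hz2⟩ := hball z hz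
      have hp : 0 < ‖(t : ℂ) - z‖ := norm_pos_iff.2 (hne z hz1 t)
      have h1 : ‖1 + (t : ℂ) ^ 2‖ = 1 + t ^ 2 := by
        rw [← Complex.ofReal_one, ← Complex.ofReal_pow, ← Complex.ofReal_add, Complex.norm_real,
          Real.norm_of_nonneg (by positivity)]
      have h2 : z₀.im ^ 2 + (z₀.re - t) ^ 2 = ‖(t : ℂ) - z₀‖ ^ 2 := by
        rw [← Complex.normSq_eq_norm_sq, Complex.normSq_apply]
        simp
        ring
      have h3 : ‖(t : ℂ) - z₀‖ ^ 2 ≤ 4 * ‖(t : ℂ) - z‖ ^ 2 := by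
        have := pow_le_pow_left₀ (norm_nonneg _) (hz2 t) 2
        linarith
      have h4 : 0 < ‖(t : ℂ) - z₀‖ := norm_pos_iff.2 (hne z₀ hz₀ t)
      rw [norm_mul, norm_div, norm_pow, h1, Complex.norm_real, Real.norm_of_nonneg
        (mul_nonneg (halfPlaneKernel_pos 0 one_pos t).le (h.nu_nonneg t)), halfPlaneKernel_zero_one]
      rw [halfPlaneKernel, h2]
      have h5 : (1 + t ^ 2) / ‖(t : ℂ) - z‖ ^ 2 * ((1 + t ^ 2)⁻¹ * ν t)
          = ν t / ‖(t : ℂ) - z‖ ^ 2 := by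
        field_simp
      have h6 : 4 / z₀.im * (z₀.im / ‖(t : ℂ) - z₀‖ ^ 2 * ν t)
          = 4 * ν t / ‖(t : ℂ) - z₀‖ ^ 2 := by
        field_simp
      rw [h5, h6, div_le_div_iff₀ (by positivity) (by positivity)]
      nlinarith [mul_le_mul_of_nonneg_left h3 (h.nu_nonneg t)]
    · obtain ⟨hz1, -⟩ := hball z hz
      have hd := (hasDerivAt_id z).add ((((hasDerivAt_id z).pow 2).const_add 1).div
        ((hasDerivAt_id z).const_sub (t : ℂ)) (hne z hz1 t))
      refine (hd.mul_const (m t : ℂ)).congr_deriv ?_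
      have := hne z hz1 t
      simp only [id, Pi.pow_apply]
      field_simp
      push_cast
      ring
  intro z₀ hz₀
  have hev : V =ᶠ[𝓝 z₀] fun z => (α * z + G z).im := by
    filter_upwards [hopen.mem_nhds hz₀] with z hz
    have hz : 0 < z.im := hz
    rw [show z = ⟨z.re, z.im⟩ from rfl, h.eq z.re z.im hz, Complex.add_im, Complex.im_ofReal_mul]
    congr 1
    have h1 := integral_im (𝕜 := ℂ) (hFi z hz)
    simp only [RCLike.im_to_complex] at h1
    rw [hG]
    simp only
    rw [← h1]
    refine integral_congr_ae (ae_of_all _ fun t => ?_)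
    have hD : (t - z.re) * (t - z.re) + z.im * z.im ≠ 0 :=
      (add_pos_of_nonneg_of_pos (mul_self_nonneg _) (mul_pos hz hz)).ne'
    have hD' : z.im ^ 2 + (z.re - t) ^ 2 ≠ 0 := by positivity
    have hN : z + (1 + z ^ 2) / ((t : ℂ) - z) = (1 + t * z) / ((t : ℂ) - z) := by
      have := hne z hz t
      field_simp
      ring
    simp only
    rw [Complex.im_mul_ofReal, hN, Complex.div_im, Complex.normSq_apply, hm]
    simp only [halfPlaneKernel_zero_one]
    simp only [halfPlaneKernel, Complex.add_im, Complex.add_re,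
      Complex.one_re, Complex.one_im, Complex.re_ofReal_mul, Complex.im_ofReal_mul, Complex.sub_re,
      Complex.sub_im, Complex.ofReal_re, Complex.ofReal_im, zero_sub, neg_mul_neg, zero_add]
    field_simp
    ring
  rw [InnerProductSpace.harmonicAt_congr_nhds hev]
  refine AnalyticAt.harmonicAt_im (f := fun z => α * z + G z) ?_
  exact (by fun_prop : AnalyticAt ℂ (fun z : ℂ => (α : ℂ) * z) z₀).fun_add
    (hGd.analyticAt (hopen.mem_nhds hz₀))

theorem isHarmonicNonnegMonotone (h : IsRepresentedBy V α ν) : IsHarmonicNonnegMonotone V where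
  harmonic := h.harmonicOnNhd
  nonneg x y hy := by
    rw [h.eq x y hy]
    exact add_nonneg (mul_nonneg h.alpha_nonneg hy.le) (integral_nonneg fun t =>
      mul_nonneg (halfPlaneKernel_pos x hy t).le (h.nu_nonneg t))
  partialX_nonneg _ _ hy := (h.monotone hy).deriv_nonneg

/-! ### Uniqueness of the representation -/

theorem tendsto_div_atTop (h : IsRepresentedBy V α ν) :
    Tendsto (fun y : ℝ => V ⟨0, y⟩ / y) atTop (𝓝 α) := by
  have hlim : Tendsto (fun y : ℝ => ∫ t, halfPlaneKernel 0 y t * ν t / y) atTop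
      (𝓝 (∫ _ : ℝ, (0 : ℝ))) := by
    refine tendsto_integral_filter_of_dominated_convergence
      (fun t => halfPlaneKernel 0 1 t * ν t) ?_ ?_ (h.integrable 0 one_pos) ?_
    · filter_upwards [eventually_gt_atTop 0] with y hy
      exact ((h.integrable 0 hy).div_const y).aestronglyMeasurable
    · filter_upwards [eventually_ge_atTop 1] with y hy
      refine ae_of_all _ fun t => ?_
      have hy0 : 0 < y := one_pos.trans_le hy
      rw [Real.norm_of_nonneg (div_nonneg (mul_nonneg (halfPlaneKernel_pos 0 hy0 t).le
        (h.nu_nonneg t)) hy0.le), mul_div_right_comm]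
      refine mul_le_mul_of_nonneg_right ?_ (h.nu_nonneg t)
      rw [halfPlaneKernel_zero_one, halfPlaneKernel, div_div, mul_comm, div_mul_cancel_left₀ hy0.ne']
      exact inv_anti₀ (by positivity) (by nlinarith)
    · refine ae_of_all _ fun t => ?_
      have h1 : Tendsto (fun y : ℝ => ν t / (y ^ 2 + t ^ 2)) atTop (𝓝 0) :=
        tendsto_const_nhds.div_atTop
          (tendsto_atTop_add_const_right _ _ (tendsto_pow_atTop two_ne_zero))
      refine h1.congr' ?_
      filter_upwards [eventually_gt_atTop 0] with y hy
      rw [halfPlaneKernel, zero_sub, neg_sq]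
      field_simp
  rw [integral_zero] at hlim
  have h2 := hlim.const_add α
  rw [add_zero] at h2
  refine h2.congr' ?_
  filter_upwards [eventually_gt_atTop 0] with y hy
  rw [h.eq 0 y hy, integral_div]
  field_simp

theorem tendsto_nhdsGT_zero (h : IsRepresentedBy V α ν) {x : ℝ} (hx : ContinuousAt ν x) :
    Tendsto (fun y : ℝ => V ⟨x, y⟩) (𝓝[>] 0) (𝓝 (Real.pi * ν x)) := by
  have hlim : Tendsto (fun y : ℝ => ∫ s, (1 + s ^ 2)⁻¹ * ν (x + y * s)) (𝓝[>] 0)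
      (𝓝 (∫ s, (1 + s ^ 2)⁻¹ * ν x)) := by
    have hb := (integrable_halfPlaneKernel_mul_iff_comp one_pos).1 (h.integrable x one_pos)
    refine tendsto_integral_filter_of_dominated_convergence
      -- For 0 < y < 1 the point x + ys lies between x and x + s, so monotonicity bounds ν there by
      -- the sum of the two end values.
      (fun s => (1 + s ^ 2)⁻¹ * ν x + (1 + s ^ 2)⁻¹ * ν (x + 1 * s)) ?_ ?_
      ((integrable_inv_one_add_sq.mul_const _).add hb) ?_
    · filter_upwards [self_mem_nhdsWithin] with y hy
      exact ((integrable_halfPlaneKernel_mul_iff_comp hy).1 (h.integrable x hy)).aestronglyMeasurable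
    · filter_upwards [Ioo_mem_nhdsGT one_pos] with y hy
      refine ae_of_all _ fun s => ?_
      have hp : 0 ≤ (1 + s ^ 2)⁻¹ := by positivity
      rw [Real.norm_of_nonneg (mul_nonneg hp (h.nu_nonneg _)), ← mul_add]
      refine mul_le_mul_of_nonneg_left ?_ hp
      rcases le_total 0 s with hs | hs
      · have := h.nu_mono (show x + y * s ≤ x + 1 * s by nlinarith [hy.2])
        linarith [h.nu_nonneg x]
      · have := h.nu_mono (show x + y * s ≤ x by nlinarith [hy.1])
        linarith [h.nu_nonneg (x + 1 * s)]
    · refine ae_of_all _ fun s => Tendsto.const_mul _ ?_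
      have h1 : Tendsto (fun y : ℝ => x + y * s) (𝓝[>] 0) (𝓝 x) := by
        have : Continuous fun y : ℝ => x + y * s := by fun_prop
        simpa using (this.tendsto 0).mono_left nhdsWithin_le_nhds
      exact hx.tendsto.comp h1
  rw [integral_mul_const, integral_univ_inv_one_add_sq] at hlim
  have h2 : Tendsto (fun y : ℝ => α * y) (𝓝[>] 0) (𝓝 0) := by
    have : Continuous fun y : ℝ => α * y := by fun_prop
    simpa using (this.tendsto 0).mono_left nhdsWithin_le_nhds
  have h3 := h2.add hlim
  rw [zero_add] at h3
  refine h3.congr' ?_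
  filter_upwards [self_mem_nhdsWithin] with y hy
  exact (h.eq_integral_comp x hy).symm

theorem unique {α' : ℝ} {ν' : ℝ → ℝ} (h : IsRepresentedBy V α ν) (h' : IsRepresentedBy V α' ν') :
    α' = α ∧ ν' =ᵐ[volume] ν := by
  refine ⟨tendsto_nhds_unique h'.tendsto_div_atTop h.tendsto_div_atTop, ?_⟩
  filter_upwards [h.nu_mono.countable_not_continuousAt.ae_notMem volume,
    h'.nu_mono.countable_not_continuousAt.ae_notMem volume] with t ht ht'
  exact mul_left_cancel₀ Real.pi_ne_zero (tendsto_nhds_unique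
    (h'.tendsto_nhdsGT_zero (not_not.1 ht')) (h.tendsto_nhdsGT_zero (not_not.1 ht)))

theorem congr_ae {ν' : ℝ → ℝ} (h : IsRepresentedBy V α ν) (hm : Monotone ν')
    (hae : ν' =ᵐ[volume] ν) : IsRepresentedBy V α ν' where
  alpha_nonneg := h.alpha_nonneg
  nu_nonneg := hm.le_of_ae_le (hae.mono fun t ht => ht ▸ h.nu_nonneg t)
  nu_mono := hm
  nu_integrable := h.nu_integrable.congr <| (ae_restrict_of_ae hae).mono fun t ht => by
    simp only [ht]
  eq x y hy := by
    rw [h.eq x y hy]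
    congr 1
    exact integral_congr_ae <| hae.mono fun t ht => by simp only [ht]

theorem of_const {β a : ℝ} (hβ : 0 ≤ β) (ha : 0 ≤ a)
    (h : ∀ x y : ℝ, 0 < y → V ⟨x, y⟩ = β * y + a * Real.pi) :
    IsRepresentedBy V β fun _ => a where
  alpha_nonneg := hβ
  nu_nonneg _ := ha
  nu_mono := monotone_const
  nu_integrable := (monotone_const.integrableOn_div_sq_iff fun _ => ha).2
    ((integrable_halfPlaneKernel 0 one_pos).mul_const a)
  eq x y hy := by
    rw [h x y hy, integral_mul_const, integral_halfPlaneKernel x hy, mul_comm a]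

theorem eq_of_forall_eq {a : ℝ} (h : IsRepresentedBy V α ν) (hν : ∀ t, ν t = a) (x : ℝ) {y : ℝ}
    (hy : 0 < y) : V ⟨x, y⟩ = α * y + a * Real.pi := by
  simp only [h.eq x y hy, hν, integral_mul_const, integral_halfPlaneKernel x hy, mul_comm a]

/-! ### Positivity of the derivative -/

/-- Translating ν by δ adds mass at least δ(ν b − ν a) on [a − 1, b + 1], where the kernel has a
positive minimum; this bounds the difference quotients from below. -/
theorem partialX_pos (h : IsRepresentedBy V α ν) {a b : ℝ} (hab : ν a < ν b) (x : ℝ) {y : ℝ}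
    (hy : 0 < y) : 0 < partialX V x y := by
  have hab' : a < b := h.nu_mono.reflect_lt hab
  obtain ⟨t₀, -, ht₀⟩ := isCompact_Icc.exists_isMinOn
    (nonempty_Icc.2 (show a - 1 ≤ b + 1 by linarith)) (continuous_halfPlaneKernel x hy).continuousOn
  set m := halfPlaneKernel x y t₀ with hm
  have hm0 : 0 < m := halfPlaneKernel_pos x hy t₀
  have hincr : ∀ δ : ℝ, 0 < δ → δ < 1 →
      m * (δ * (ν b - ν a)) ≤ V ⟨x + δ, y⟩ - V ⟨x, y⟩ := by
    intro δ hδ hδ1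
    have hshift : (fun s : ℝ => (1 + s ^ 2)⁻¹ * ν (x + δ + y * s))
        = fun s : ℝ => (1 + s ^ 2)⁻¹ * ν (x + y * s + δ) := by
      ext s
      rw [add_right_comm]
    have hi : Integrable fun t => halfPlaneKernel x y t * ν (t + δ) := by
      have h1 := (integrable_halfPlaneKernel_mul_iff_comp hy).1 (h.integrable (x + δ) hy)
      rw [hshift] at h1
      exact (integrable_halfPlaneKernel_mul_iff_comp hy (g := fun t => ν (t + δ))).2 h1
    have hnn : ∀ t, 0 ≤ ν (t + δ) - ν t := fun t =>
      sub_nonneg.2 (h.nu_mono (by linarith))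
    have hdiff : V ⟨x + δ, y⟩ - V ⟨x, y⟩
        = ∫ t, halfPlaneKernel x y t * (ν (t + δ) - ν t) := by
      rw [h.eq_integral_comp (x + δ) hy, hshift,
        ← integral_halfPlaneKernel_mul hy (fun t => ν (t + δ)), h.eq x y hy]
      simp only [mul_sub]
      rw [integral_sub hi (h.integrable x hy)]
      ring
    have hint : ∀ c d : ℝ, IntervalIntegrable ν volume c d := fun c d => h.nu_mono.intervalIntegrable
    have hmδ : Monotone fun t => ν (t + δ) := fun s t hst => h.nu_mono (by linarith)
    have hintδ : IntervalIntegrable (fun t => ν (t + δ)) volume (a - 1) (b + 1) :=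
      hmδ.intervalIntegrable
    have hI : IntegrableOn (fun t => ν (t + δ) - ν t) (Icc (a - 1) (b + 1)) := by
      rw [integrableOn_Icc_iff_integrableOn_Ioc,
        ← intervalIntegrable_iff_integrableOn_Ioc_of_le (by linarith)]
      exact hintδ.sub (hint _ _)
    -- The integral telescopes to two end strips of width δ. As δ < 1, the left one lies below a and
    -- the right one above b.
    have hlower : δ * (ν b - ν a) ≤ ∫ t in Icc (a - 1) (b + 1), (ν (t + δ) - ν t) := by
      rw [integral_Icc_eq_integral_Ioc, ← intervalIntegral.integral_of_le (by linarith),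
        intervalIntegral.integral_sub hintδ (hint _ _),
        intervalIntegral.integral_comp_add_right (fun t => ν t) δ,
        intervalIntegral.integral_interval_sub_interval_comm (hint _ _) (hint _ _) (hint _ _),
        intervalIntegral.integral_symm, intervalIntegral.integral_symm (b + 1) (b + 1 + δ)]
      have hr : δ * ν b ≤ ∫ t in (b + 1)..(b + 1 + δ), ν t := by
        have := intervalIntegral.integral_mono_on (by linarith) intervalIntegrable_const
          (hint (b + 1) (b + 1 + δ)) fun t ht => h.nu_mono (show b ≤ t by linarith [ht.1])
        simpa using this
      have hl : ∫ t in (a - 1)..(a - 1 + δ), ν t ≤ δ * ν a := by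
        have := intervalIntegral.integral_mono_on (by linarith) (hint (a - 1) (a - 1 + δ))
          intervalIntegrable_const fun t ht => h.nu_mono (show t ≤ a by linarith [ht.2])
        simpa using this
      linarith
    have hiD : Integrable fun t => halfPlaneKernel x y t * (ν (t + δ) - ν t) := by
      simp only [mul_sub]
      exact hi.sub (h.integrable x hy)
    rw [hdiff]
    calc m * (δ * (ν b - ν a)) ≤ m * ∫ t in Icc (a - 1) (b + 1), (ν (t + δ) - ν t) :=
          mul_le_mul_of_nonneg_left hlower hm0.le
      _ = ∫ t in Icc (a - 1) (b + 1), m * (ν (t + δ) - ν t) := (integral_const_mul _ _).symm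
      _ ≤ ∫ t in Icc (a - 1) (b + 1), halfPlaneKernel x y t * (ν (t + δ) - ν t) :=
          setIntegral_mono_on (hI.const_mul m) hiD.integrableOn measurableSet_Icc fun t ht =>
            mul_le_mul_of_nonneg_right (ht₀ ht) (hnn t)
      _ ≤ ∫ t, halfPlaneKernel x y t * (ν (t + δ) - ν t) :=
          setIntegral_le_integral hiD (ae_of_all _ fun t =>
            mul_nonneg (halfPlaneKernel_pos x hy t).le (hnn t))
  have hd := (h.isHarmonicNonnegMonotone.differentiableAt hy x).hasDerivAt.tendsto_slope_zero_right
  refine lt_of_lt_of_le (mul_pos hm0 (sub_pos.2 hab)) (ge_of_tendsto hd ?_)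
  filter_upwards [Ioo_mem_nhdsGT one_pos] with δ hδ
  rw [smul_eq_mul, inv_mul_eq_div, le_div_iff₀ hδ.1]
  linarith [hincr δ hδ.1 hδ.2]

theorem partialX_eq_zero_of_forall_eq {a : ℝ} (h : IsRepresentedBy V α ν) (hν : ∀ t, ν t = a)
    (x : ℝ) {y : ℝ} (hy : 0 < y) : partialX V x y = 0 := by
  have : (fun s : ℝ => V ⟨s, y⟩) = fun _ => α * y + a * Real.pi :=
    funext fun s => h.eq_of_forall_eq hν s hy
  rw [partialX, this, deriv_const]

/-- If `V_x` vanishes at one point, then the representing function is constant. -/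
theorem exists_forall_eq_of_partialX_eq_zero (h : IsRepresentedBy V α ν) {x y : ℝ} (hy : 0 < y)
    (h0 : partialX V x y = 0) : ∃ a : ℝ, 0 ≤ a ∧ ∀ t, ν t = a := by
  refine ⟨ν 0, h.nu_nonneg 0, fun t => ?_⟩
  by_contra hne
  rcases lt_or_gt_of_ne hne with hlt | hlt <;> exact (h.partialX_pos hlt x hy).ne' h0

theorem forall_partialX_eq_zero_iff (h : IsRepresentedBy V α ν) :
    (∀ x y : ℝ, 0 < y → partialX V x y = 0) ↔ ∃ a : ℝ, 0 ≤ a ∧ ∀ t, ν t = a :=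
  ⟨fun h0 => h.exists_forall_eq_of_partialX_eq_zero one_pos (h0 0 1 one_pos),
    fun ⟨_, _, hν⟩ x _ hy => h.partialX_eq_zero_of_forall_eq hν x hy⟩

end IsRepresentedBy

theorem theorem2p1 (V : ℂ → ℝ) :
    -- existence of the representation, and its converse
    (IsHarmonicNonnegMonotone V ↔ ∃ (α : ℝ) (ν : ℝ → ℝ), IsRepresentedBy V α ν) ∧
    -- for every representation the integral converges, and the representations of `V` are
    -- exactly those with the same `α` and a non-decreasing function equal to `ν` a.e.
    (∀ (α : ℝ) (ν : ℝ → ℝ), IsRepresentedBy V α ν →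
      (∀ x y : ℝ, 0 < y → Integrable (fun t : ℝ => halfPlaneKernel x y t * ν t)) ∧
      (∀ (α' : ℝ) (ν' : ℝ → ℝ), IsRepresentedBy V α' ν' ↔
        (α' = α ∧ Monotone ν' ∧ ν' =ᵐ[volume] ν))) ∧
    -- the alternative, and the characterization of its second case
    (IsHarmonicNonnegMonotone V →
      ((∀ x y : ℝ, 0 < y → 0 < partialX V x y) ∨ (∀ x y : ℝ, 0 < y → partialX V x y = 0)) ∧
      ((∀ x y : ℝ, 0 < y → partialX V x y = 0) ↔
        ∃ α a : ℝ, 0 ≤ α ∧ 0 ≤ a ∧ ∀ x y : ℝ, 0 < y → V ⟨x, y⟩ = α * y + a * Real.pi) ∧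
      (∀ (α : ℝ) (ν : ℝ → ℝ), IsRepresentedBy V α ν →
        ((∀ x y : ℝ, 0 < y → partialX V x y = 0) ↔ ∃ a : ℝ, 0 ≤ a ∧ ∀ t : ℝ, ν t = a) ∧
        (∀ β a : ℝ, 0 ≤ β → 0 ≤ a →
          ((∀ x y : ℝ, 0 < y → V ⟨x, y⟩ = β * y + a * Real.pi) ↔
            (β = α ∧ ∀ t : ℝ, ν t = a))))) := by
  refine ⟨⟨fun hV => hV.exists_isRepresentedBy, fun ⟨_, _, h⟩ => h.isHarmonicNonnegMonotone⟩,
    fun α ν h => ⟨fun x _ hy => h.integrable x hy, fun α' ν' => ⟨fun h' => ?_, ?_⟩⟩,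
    fun hV => ⟨?_, ?_, fun α ν h => ⟨h.forall_partialX_eq_zero_iff, fun β a hβ ha => ⟨fun hc => ?_, ?_⟩⟩⟩⟩
  · exact ⟨(h.unique h').1, h'.nu_mono, (h.unique h').2⟩
  · rintro ⟨rfl, hm, hae⟩
    exact h.congr_ae hm hae
  · obtain ⟨α, ν, h⟩ := hV.exists_isRepresentedBy
    by_cases hconst : ∃ a : ℝ, 0 ≤ a ∧ ∀ t, ν t = a
    · exact Or.inr (h.forall_partialX_eq_zero_iff.2 hconst)
    · exact Or.inl fun x y hy => (hV.partialX_nonneg x y hy).lt_of_ne' fun h0 =>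
        hconst (h.exists_forall_eq_of_partialX_eq_zero hy h0)
  · constructor
    · intro h0
      obtain ⟨α, ν, h⟩ := hV.exists_isRepresentedBy
      obtain ⟨a, ha, hν⟩ := h.forall_partialX_eq_zero_iff.1 h0
      exact ⟨α, a, h.alpha_nonneg, ha, fun x y hy => h.eq_of_forall_eq hν x hy⟩
    · rintro ⟨α, a, hα, ha, hc⟩ x y hy
      exact (IsRepresentedBy.of_const hα ha hc).partialX_eq_zero_of_forall_eq (fun _ => rfl) x hy
  -- Uniqueness gives ν = a only almost everywhere; monotonicity upgrades this to every t.
  · have hu := h.unique (IsRepresentedBy.of_const hβ ha hc)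
    refine ⟨hu.1, fun t => le_antisymm ?_ ?_⟩
    · exact h.nu_mono.ge_of_ae_ge (hu.2.mono fun s hs => hs.symm.le) t
    · exact h.nu_mono.le_of_ae_le (hu.2.mono fun s hs => hs.le) t
  · rintro ⟨rfl, hν⟩ x y hy
    exact h.eq_of_forall_eq hν x hy
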